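/- **Theorem.** Fix variables $x_1,\dots,x_n$ (inputs) and $y_1,\dots,y_s$ (non-deterministic, or auxiliary, variables), $n,s\ge 0$. A clause is a finite set of literals over these $n+s$ variables that does not contain a literal together with its negation; its width is its number of literals. A CNF $F$ is a finite set of clauses, and $F(x,y)=1$ if every clause of $F$ contains a literal that is true under $(x,y)$. Let $\mathrm{PAR}_n(x)=x_1\oplus\dots\oplus x_n$. We say that $F$ is a CNF encoding of $\mathrm{PAR}_n$ with $s$ non-deterministic variables if for every $x\in\{0,1\}^n$: $\mathrm{PAR}_n(x)=1$ if and only if there is $y\in\{0,1\}^s$ with $F(x,y)=1$. Let $F$ be a CNF encoding of $\mathrm{PAR}_n$ with $m$ clauses, $s$ non-deterministic variables and maximum clause width $k$. 1. If $n\ge 1$ and $s=O(n)$, then $m\ge\Omega\left(\frac{s+1}{n}\,2^{n/(s+1)}\right)$. That is, for every $K$ there is a constant $c>0$, depending only on $K$, such that $m\ge c\,\frac{s+1}{n}\,2^{n/(s+1)}$ whenever $n\ge 1$ and $s\le Kn$. Moreover, with no restriction on $s$, $m\ge\Omega\left(\frac{1}{n}\,2^{n/(s+1)}\right)$: there is an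 absolute constant $c>0$ such that $m\ge \frac{c}{n}\,2^{n/(s+1)}$ whenever $n\ge 1$. 2. $k\ge n/(s+1)$. 3. $m\ge 3n-9$ (for any number $s$ of non-deterministic variables). -/

import Mathlib

/-- A literal over the variables `V`: the pair `(v, true)` is the literal `v`, and `(v, false)` is
its negation. -/
abbrev Literal (V : Type*) := V × Bool

/-- A clause: a finite set of literals that does not contain a literal together with its
negation. It stands for the disjunction of its literals. -/
abbrev Clause (V : Type*) :=
  {C : Finset (Literal V) // ∀ v : V, ¬ ((v, true) ∈ C ∧ (v, false) ∈ C)}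

/-- A formula in conjunctive normal form: a finite set of clauses. -/
abbrev CNF (V : Type*) := Finset (Clause V)

/-- The clause `C` is satisfied by the assignment `a`. -/
def Clause.IsSat {V : Type*} (C : Clause V) (a : V → Bool) : Prop :=
  ∃ l ∈ C.1, a l.1 = l.2

/-- The formula `F` is satisfied by the assignment `a`. -/
def CNF.IsSat {V : Type*} (F : CNF V) (a : V → Bool) : Prop :=
  ∀ C ∈ F, Clause.IsSat C a

/-- The number of clauses of a formula. -/
def CNF.numClauses {V : Type*} (F : CNF V) : ℕ :=
  F.card

/-- The maximum clause width, that is, the maximum number of literals in a clause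
(zero for the empty formula). -/
def CNF.width {V : Type*} (F : CNF V) : ℕ :=
  F.sup fun C => C.1.card

/-- `F`, over the input variables `Sum.inl i` and the non-deterministic variables `Sum.inr j`,
encodes the Boolean function `f`. -/
def CNF.Encodes {n s : ℕ} (F : CNF (Fin n ⊕ Fin s)) (f : (Fin n → Bool) → Bool) : Prop :=
  ∀ x : Fin n → Bool, f x = true ↔ ∃ y : Fin s → Bool, CNF.IsSat F (Sum.elim x y)

/-- The parity function `x₁ ⊕ x₂ ⊕ ⋯ ⊕ xₙ`: it is true when an odd number of the bits are true. -/
def parity (n : ℕ) (x : Fin n → Bool) : Bool :=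
  decide (Odd (Finset.univ.filter fun i => x i = true).card)

/-!
# Lower bounds for CNF encodings of parity

*Width and exponential size.* Fix a satisfying `y` for every odd input `x`. Since flipping any bit of
`x` makes it even, each pair `(x, i)` has a critical clause, whose only true literal under `(x, y)`
is the one on `xᵢ`; let `w` be the number of inputs in it. For a fixed order of the inputs, let
`D(x)` be the set of those `i` that come last in their critical clause. For the `x` with
the same `y`, the subcubes through `x` with free coordinates `D(x)` are disjoint, so
`∑ₓ 2 ^ |D(x)| ≤ 2 ^ (n + s)`, which bounds the average of `|D(x)|` over the odd inputs by `s + 1`.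
Averaging over all orders, `∑ᵢ 1 / w` is on average at most `s + 1`
(`ParityEncoding.sum_inv_card_le`). As `w ≤ k`, this gives `n / k ≤ s + 1`. On the other hand a
clause with `w` inputs is critical for at most `w 2ⁿ⁻ʷ` pairs, so the sum of `2ʷ / w` over all pairs is
at most `m 2ⁿ`; convexity of `2ʷ` at `t = n / (s + 1)` then yields
`2 m ≥ 2ᵗ min (s + 1, n log 2)` (`ParityEncoding.two_rpow_mul_min_le`), from which both size bounds
follow.

*Linear size.* In an encoding with the fewest clauses among the counterexamples, no literal of an input
occurs three times, since making it true would remove three clauses at the price of one input. If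
a literal of an input `x` occurs only once, in a clause `C`, then `C` is the critical clause for `x`
whenever the literal is true, so its other literals are on auxiliary variables and are forced to be
false. If there is only one of them, its variable always equals `x` up to a sign; after
exchanging the roles of the two, `x` can be eliminated by resolution, which saves a clause. Otherwise
set `x` so that its literal is true, and two of the others to their forced value. This
satisfies `C`; at least two clauses for the first of them, since in a minimal encoding the
negation of an auxiliary literal occurs at least twice; and one more clause, critical for the second
(`ParityEncoding.EncodesParity.exists_card_add_four_le`). Hence each literal of each input occurs
exactly twice. If no two of them shared a clause, there would be `4n` clauses. If two of them share a
clause, making one true removes two clauses and leaves the other one with a single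
occurrence, so that four more clauses go with it: six clauses for two inputs
(`ParityEncoding.EncodesParity.three_mul_card_le`).
-/

namespace ParityEncoding

open Finset Function

section Formulas

variable {V : Type*}

/-! ### Formulas encoding parity on a set of input variables -/

/-- The sum modulo 2 of the values that `a` gives to the variables in `X`. -/
def parityOn (X : Finset V) (a : V → Bool) : ZMod 2 :=
  ∑ v ∈ X, if a v then 1 else 0

/-- The assignment `a` satisfies every clause in `F`. Clauses are here arbitrary finite sets of
literals, so that the operations on formulas below need no proof that their results are
not tautological. -/
def Satisfies (a : V → Bool) (F : Finset (Finset (Literal V))) : Prop :=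
  ∀ C ∈ F, ∃ l ∈ C, a l.1 = l.2

/-- `F` encodes "the inputs in `X` have parity `b`". All variables outside `X` are auxiliary; the
ambient type `V` never changes when a variable is eliminated, and the sign `b` absorbs the
inputs that have been set to `true`. -/
structure EncodesParity (F : Finset (Finset (Literal V))) (X : Finset V) (b : ZMod 2) : Prop where
  parity_eq : ∀ a, Satisfies a F → parityOn X a = b
  exists_sat : ∀ a, parityOn X a = b → ∃ a', (∀ v ∈ X, a' v = a v) ∧ Satisfies a' F

theorem parityOn_congr {X : Finset V} {a a' : V → Bool} (h : ∀ v ∈ X, a v = a' v) :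
    parityOn X a = parityOn X a' :=
  sum_congr rfl fun v hv => by rw [h v hv]

variable [DecidableEq V]

/-- The clauses of `F` that contain the literal `l`. -/
def occ (F : Finset (Finset (Literal V))) (l : Literal V) : Finset (Finset (Literal V)) :=
  F.filter (l ∈ ·)

/-- No clause of `F` contains a literal together with its negation. -/
def NonTautological (F : Finset (Finset (Literal V))) : Prop :=
  ∀ C ∈ F, ∀ v c, (v, c) ∈ C → (v, !c) ∉ C

theorem mem_occ {F : Finset (Finset (Literal V))} {l : Literal V} {C : Finset (Literal V)} :
    C ∈ occ F l ↔ C ∈ F ∧ l ∈ C := by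
  simp [occ]

theorem parityOn_eq_add_erase {X : Finset V} {x : V} (hx : x ∈ X) (a : V → Bool) :
    parityOn X a = (if a x then 1 else 0) + parityOn (X.erase x) a :=
  (add_sum_erase X _ hx).symm

theorem parityOn_update {X : Finset V} {x : V} (hx : x ∈ X) (a : V → Bool) (c : Bool) :
    parityOn X (update a x c) = (if c then 1 else 0) + parityOn (X.erase x) a := by
  rw [parityOn_eq_add_erase hx, update_self]
  congr 1
  exact parityOn_congr fun v hv => update_of_ne (ne_of_mem_erase hv) _ _

theorem parityOn_flip {X : Finset V} {x : V} (hx : x ∈ X) (a : V → Bool) :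
    parityOn X (update a x (!a x)) = parityOn X a + 1 := by
  rw [parityOn_update hx, parityOn_eq_add_erase hx a]
  generalize parityOn (X.erase x) a = p
  revert p
  cases a x <;> decide

theorem exists_parityOn_eq {X : Finset V} (hX : 3 ≤ X.card) {x z : V} (hxz : x ≠ z)
    (c d : Bool) (b : ZMod 2) : ∃ a, a x = c ∧ a z = d ∧ parityOn X a = b := by
  obtain ⟨u, hu, hux, huz⟩ : ∃ u ∈ X, u ≠ x ∧ u ≠ z := by
    by_contra! h
    have : X ⊆ {x, z} := fun u hu => by
      by_cases hux : u = x
      · simp [hux]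
      · simp [h u hu hux]
    have := (card_le_card this).trans card_le_two
    omega
  let a : V → Bool := update (update (fun _ => false) x c) z d
  have hx : a x = c := by simp [a, hxz]
  have hz : a z = d := by simp [a]
  by_cases h : parityOn X a = b
  · exact ⟨a, hx, hz, h⟩
  · refine ⟨update a u (!a u), by rw [update_of_ne hux.symm, hx],
      by rw [update_of_ne huz.symm, hz], ?_⟩
    rw [parityOn_flip hu]
    revert h
    generalize parityOn X a = p
    revert p b
    decide

theorem EncodesParity.exists_sat_of_ne {F : Finset (Finset (Literal V))} {X : Finset V} {b : ZMod 2}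
    (h : EncodesParity F X b) (hX : 3 ≤ X.card) {x z : V} (hx : x ∈ X) (hz : z ∈ X) (hxz : x ≠ z)
    (c d : Bool) : ∃ a, Satisfies a F ∧ a x = c ∧ a z = d := by
  obtain ⟨a, hax, haz, ha⟩ := exists_parityOn_eq hX hxz c d b
  obtain ⟨a', haa, hs⟩ := h.exists_sat a ha
  exact ⟨a', hs, by rw [haa x hx, hax], by rw [haa z hz, haz]⟩

theorem EncodesParity.exists_sat_eq {F : Finset (Finset (Literal V))} {X : Finset V} {b : ZMod 2}
    (h : EncodesParity F X b) (hX : 3 ≤ X.card) {x : V} (hx : x ∈ X) (c : Bool) :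
    ∃ a, Satisfies a F ∧ a x = c := by
  obtain ⟨z, hz, hzx⟩ := exists_mem_ne (by omega : 1 < X.card) x
  obtain ⟨a, hs, hax, -⟩ := h.exists_sat_of_ne hX hx hz hzx.symm c true
  exact ⟨a, hs, hax⟩

/-- If changing the value of `v` destroys a satisfying assignment, then some clause is satisfied
by the literal of `v` only. -/
theorem exists_critical_of_flip {F : Finset (Finset (Literal V))} {a : V → Bool}
    (ha : Satisfies a F) {v : V} (hv : ¬ Satisfies (update a v (!a v)) F) :
    ∃ C ∈ F, (v, a v) ∈ C ∧ ∀ l ∈ C, a l.1 = l.2 → l = (v, a v) := by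
  simp only [Satisfies, not_forall, not_exists, not_and] at hv
  obtain ⟨C, hC, hall⟩ := hv
  have key : ∀ l ∈ C, a l.1 = l.2 → l = (v, a v) := by
    rintro ⟨u, c⟩ hl hac
    by_cases huv : u = v
    · subst huv
      exact Prod.ext rfl hac.symm
    · exact absurd (by simpa [update_of_ne huv] using hac) (hall _ hl)
  obtain ⟨l, hl, hal⟩ := ha C hC
  exact ⟨C, hC, key l hl hal ▸ hl, key⟩

/-- Every input variable has a critical clause at every satisfying assignment. -/
theorem EncodesParity.exists_critical {F : Finset (Finset (Literal V))} {X : Finset V} {b : ZMod 2}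
    (h : EncodesParity F X b) {a : V → Bool} (ha : Satisfies a F) {x : V} (hx : x ∈ X) :
    ∃ C ∈ F, (x, a x) ∈ C ∧ ∀ l ∈ C, a l.1 = l.2 → l = (x, a x) := by
  refine exists_critical_of_flip ha fun hs => ?_
  have h1 := h.parity_eq _ hs
  rw [parityOn_flip hx, h.parity_eq _ ha] at h1
  exact one_ne_zero (left_eq_add.mp h1.symm)

/-! ### Simplifying a formula -/

/-- The formula obtained from `F` by giving the variables in `T` their values under `a₀`. -/
def restrict (F : Finset (Finset (Literal V))) (T : Finset V) (a₀ : V → Bool) :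
    Finset (Finset (Literal V)) :=
  (F.filter fun C => ∀ l ∈ C, l.1 ∈ T → a₀ l.1 ≠ l.2).image fun C => C.filter fun l => l.1 ∉ T

/-- Setting an input `x` to the value `a₀ x`, together with auxiliary variables whose
values are thereby forced, gives an encoding of parity on the remaining inputs. -/
theorem EncodesParity.restrict {F : Finset (Finset (Literal V))} {X : Finset V} {b : ZMod 2}
    (h : EncodesParity F X b) {x : V} (hx : x ∈ X) {T : Finset V} (hxT : x ∈ T)
    (hT : ∀ v ∈ T, v ∈ X → v = x) {a₀ : V → Bool}
    (hforced : ∀ a, Satisfies a F → a x = a₀ x → ∀ v ∈ T, a v = a₀ v) :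
    EncodesParity (restrict F T a₀) (X.erase x) (b - if a₀ x then 1 else 0) where
  parity_eq a ha := by
    let a' : V → Bool := fun v => if v ∈ T then a₀ v else a v
    have hs : Satisfies a' F := by
      intro C hC
      by_cases hk : ∀ l ∈ C, l.1 ∈ T → a₀ l.1 ≠ l.2
      · obtain ⟨l, hl, hal⟩ := ha _ (mem_image_of_mem _ (mem_filter.mpr ⟨hC, hk⟩))
        rw [mem_filter] at hl
        exact ⟨l, hl.1, by simp only [a', if_neg hl.2, hal]⟩
      · push Not at hk
        obtain ⟨l, hl, hlT, hal⟩ := hk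
        exact ⟨l, hl, by simp only [a', if_pos hlT, hal]⟩
    have h1 := h.parity_eq _ hs
    rw [parityOn_eq_add_erase hx] at h1
    have h2 : parityOn (X.erase x) a' = parityOn (X.erase x) a := parityOn_congr fun v hv => by
      have : v ∉ T := fun hvT => ne_of_mem_erase hv (hT v hvT (mem_of_mem_erase hv))
      simp only [a', if_neg this]
    have h3 : a' x = a₀ x := if_pos hxT
    rw [← h1, h2, h3, add_sub_cancel_left]
  exists_sat a ha := by
    have h1 : parityOn X (update a x (a₀ x)) = b := by
      rw [parityOn_update hx, ha, add_sub_cancel]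
    obtain ⟨a', haa, hs⟩ := h.exists_sat _ h1
    have hf := hforced a' hs (by rw [haa x hx, update_self])
    refine ⟨a', fun v hv => ?_, ?_⟩
    · rw [haa v (mem_of_mem_erase hv), update_of_ne (ne_of_mem_erase hv)]
    · intro C' hC'
      obtain ⟨C, hC, rfl⟩ := mem_image.mp hC'
      rw [mem_filter] at hC
      obtain ⟨l, hl, hal⟩ := hs C hC.1
      refine ⟨l, mem_filter.mpr ⟨hl, fun hlT => hC.2 l hl hlT ?_⟩, hal⟩
      rw [← hf _ hlT, hal]

/-- A restriction loses all clauses that contain a literal made true. -/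
theorem card_restrict_add_le {F : Finset (Finset (Literal V))} {T : Finset V} {a₀ : V → Bool}
    {K : Finset (Finset (Literal V))} (hK : ∀ C ∈ K, C ∈ F ∧ ∃ l ∈ C, l.1 ∈ T ∧ a₀ l.1 = l.2) :
    (restrict F T a₀).card + K.card ≤ F.card := by
  have h1 : (restrict F T a₀).card ≤ (F.filter fun C => ∀ l ∈ C, l.1 ∈ T → a₀ l.1 ≠ l.2).card :=
    card_image_le
  have h2 : K.card ≤ (F.filter fun C => ¬ ∀ l ∈ C, l.1 ∈ T → a₀ l.1 ≠ l.2).card := by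
    refine card_le_card fun C hC => ?_
    obtain ⟨hF, l, hl, hlT, hal⟩ := hK C hC
    exact mem_filter.mpr ⟨hF, fun hk => hk l hl hlT hal⟩
  have h3 := card_filter_add_card_filter_not (s := F)
    (fun C => ∀ l ∈ C, l.1 ∈ T → a₀ l.1 ≠ l.2)
  omega

/-- Davis–Putnam elimination of the variable `v`: the clauses without `v`, and all resolvents
on `v`. -/
def eliminate (F : Finset (Finset (Literal V))) (v : V) : Finset (Finset (Literal V)) :=
  (F.filter fun C => ∀ l ∈ C, l.1 ≠ v) ∪
    image₂ (fun C D => (C ∪ D).filter fun l => l.1 ≠ v) (occ F (v, true)) (occ F (v, false))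

theorem EncodesParity.eliminate {F : Finset (Finset (Literal V))} {X : Finset V} {b : ZMod 2}
    (h : EncodesParity F X b) (hF : NonTautological F) {v : V} (hv : v ∉ X) :
    EncodesParity (eliminate F v) X b where
  parity_eq a ha := by
    obtain ⟨c, hc⟩ : ∃ c, Satisfies (update a v c) F := by
      -- Either all clauses containing `v` are satisfied by other literals and `v` can be set to
      -- `false`, or all clauses containing `¬v` are.
      by_cases hall : ∀ C ∈ occ F (v, true), ∃ l ∈ C, l.1 ≠ v ∧ a l.1 = l.2
      · refine ⟨false, fun C hC => ?_⟩
        by_cases h0 : (v, false) ∈ C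
        · exact ⟨_, h0, by simp⟩
        by_cases h1 : (v, true) ∈ C
        · obtain ⟨l, hl, hlv, hal⟩ := hall C (mem_occ.mpr ⟨hC, h1⟩)
          exact ⟨l, hl, by rw [update_of_ne hlv, hal]⟩
        have hn : ∀ l ∈ C, l.1 ≠ v := by
          rintro ⟨u, c⟩ hl rfl
          cases c <;> contradiction
        obtain ⟨l, hl, hal⟩ := ha C (mem_union_left _ (mem_filter.mpr ⟨hC, hn⟩))
        exact ⟨l, hl, by rw [update_of_ne (hn l hl), hal]⟩
      · push Not at hall
        obtain ⟨D, hD, hDf⟩ := hall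
        refine ⟨true, fun C hC => ?_⟩
        by_cases h1 : (v, true) ∈ C
        · exact ⟨_, h1, by simp⟩
        by_cases h0 : (v, false) ∈ C
        · obtain ⟨l, hl, hal⟩ := ha _ (mem_union_right _
            (mem_image₂_of_mem hD (mem_occ.mpr ⟨hC, h0⟩)))
          rw [mem_filter, mem_union] at hl
          obtain ⟨hlD | hlC, hlv⟩ := hl
          · exact absurd hal (hDf l hlD hlv)
          · exact ⟨l, hlC, by rw [update_of_ne hlv, hal]⟩
        have hn : ∀ l ∈ C, l.1 ≠ v := by
          rintro ⟨u, c⟩ hl rfl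
          cases c <;> contradiction
        obtain ⟨l, hl, hal⟩ := ha C (mem_union_left _ (mem_filter.mpr ⟨hC, hn⟩))
        exact ⟨l, hl, by rw [update_of_ne (hn l hl), hal]⟩
    rw [← h.parity_eq _ hc]
    exact parityOn_congr fun u hu => (update_of_ne (ne_of_mem_of_not_mem hu hv) _ _).symm
  exists_sat a ha := by
    obtain ⟨a', haa, hs⟩ := h.exists_sat a ha
    refine ⟨a', haa, fun E hE => ?_⟩
    rcases mem_union.mp hE with hE | hE
    · exact hs E (mem_filter.mp hE).1
    obtain ⟨C, hC, D, hD, rfl⟩ := mem_image₂.mp hE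
    rw [mem_occ] at hC hD
    -- A true literal of `C` or of `D` that is not on `v` survives in the resolvent.
    cases hav : a' v
    · obtain ⟨l, hl, hal⟩ := hs C hC.1
      refine ⟨l, mem_filter.mpr ⟨mem_union_left _ hl, fun hlv => ?_⟩, hal⟩
      obtain ⟨u, c⟩ := l
      obtain rfl : u = v := hlv
      obtain rfl : false = c := hav.symm.trans hal
      exact hF C hC.1 _ _ hC.2 hl
    · obtain ⟨l, hl, hal⟩ := hs D hD.1
      refine ⟨l, mem_filter.mpr ⟨mem_union_right _ hl, fun hlv => ?_⟩, hal⟩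
      obtain ⟨u, c⟩ := l
      obtain rfl : u = v := hlv
      obtain rfl : true = c := hav.symm.trans hal
      exact hF D hD.1 _ _ hD.2 hl

theorem card_eliminate_add_le {F : Finset (Finset (Literal V))} (hF : NonTautological F) (v : V) :
    (eliminate F v).card + (occ F (v, true)).card + (occ F (v, false)).card
      ≤ F.card + (occ F (v, true)).card * (occ F (v, false)).card := by
  have h1 : (eliminate F v).card ≤ (F.filter fun C => ∀ l ∈ C, l.1 ≠ v).card +
      (occ F (v, true)).card * (occ F (v, false)).card :=
    (card_union_le _ _).trans (Nat.add_le_add_left (card_image₂_le _ _ _) _)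
  have h2 : (occ F (v, true) ∪ occ F (v, false)).card
      = (occ F (v, true)).card + (occ F (v, false)).card :=
    card_union_of_disjoint (disjoint_left.mpr fun C hC hC' =>
      hF C (mem_occ.mp hC).1 _ _ (mem_occ.mp hC).2 (mem_occ.mp hC').2)
  have h3 : (occ F (v, true) ∪ occ F (v, false)).card
      ≤ (F.filter fun C => ¬ ∀ l ∈ C, l.1 ≠ v).card := by
    refine card_le_card fun C hC => ?_
    rcases mem_union.mp hC with hC | hC <;> rw [mem_occ] at hC <;>
      exact mem_filter.mpr ⟨hC.1, fun hn => hn _ hC.2 rfl⟩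
  have h4 := card_filter_add_card_filter_not (s := F) (fun C => ∀ l ∈ C, l.1 ≠ v)
  omega

/-- If `v` always equals the input `x` up to a sign, the two can exchange their roles. -/
theorem EncodesParity.swap {F : Finset (Finset (Literal V))} {X : Finset V} {b : ZMod 2}
    (h : EncodesParity F X b) {x v : V} (hx : x ∈ X) (hv : v ∉ X) {e : Bool}
    (heq : ∀ a, Satisfies a F → a v = (a x ^^ e)) :
    EncodesParity F (insert v (X.erase x)) (b + if e then 1 else 0) := by
  have hvx : v ≠ x := fun h => hv (h ▸ hx)
  have hpar : ∀ a : V → Bool, a v = (a x ^^ e) →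
      parityOn (insert v (X.erase x)) a = parityOn X a + if e then 1 else 0 := by
    intro a ha
    rw [parityOn_eq_add_erase hx, parityOn, sum_insert (fun h => hv (mem_of_mem_erase h)), ha]
    change _ + parityOn (X.erase x) a = _
    generalize parityOn (X.erase x) a = p
    revert p
    cases a x <;> cases e <;> decide
  refine ⟨fun a ha => by rw [hpar a (heq a ha), h.parity_eq a ha], fun a ha => ?_⟩
  let a₁ := update a x (a v ^^ e)
  have h1 : parityOn (insert v (X.erase x)) a₁ = parityOn (insert v (X.erase x)) a :=
    parityOn_congr fun u hu => update_of_ne (by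
      rcases mem_insert.mp hu with rfl | hu
      · exact hvx
      · exact ne_of_mem_erase hu) _ _
  have h2 : a₁ v = (a₁ x ^^ e) := by simp [a₁, hvx]
  rw [← h1, hpar a₁ h2, add_left_inj] at ha
  obtain ⟨a', haa, hs⟩ := h.exists_sat a₁ ha
  refine ⟨a', fun u hu => ?_, hs⟩
  rcases mem_insert.mp hu with rfl | hu
  · rw [heq a' hs, haa x hx, ← h2]
    exact update_of_ne hvx _ _
  · rw [haa u (mem_of_mem_erase hu)]
    exact update_of_ne (ne_of_mem_erase hu) _ _

/-! ### Clause-minimal encodings -/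

/-- No encoding of parity on the same number of inputs (over the same ambient variables) has fewer
clauses than `F`. -/
def IsMinimal (F : Finset (Finset (Literal V))) (X : Finset V) : Prop :=
  ∀ (F' : Finset (Finset (Literal V))) (X' : Finset V) (b' : ZMod 2),
    EncodesParity F' X' b' → X'.card = X.card → F.card ≤ F'.card

theorem EncodesParity.nonTautological {F : Finset (Finset (Literal V))} {X : Finset V} {b : ZMod 2}
    (h : EncodesParity F X b) (hmin : IsMinimal F X) : NonTautological F := by
  intro C hC v c hc hc'
  have hiff : ∀ a, Satisfies a (F.erase C) → Satisfies a F := by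
    intro a ha D hD
    by_cases hDC : D = C
    · subst hDC
      by_cases hav : a v = c
      · exact ⟨_, hc, hav⟩
      · exact ⟨_, hc', Bool.eq_not_of_ne hav⟩
    · exact ha D (mem_erase.mpr ⟨hDC, hD⟩)
  have henc : EncodesParity (F.erase C) X b :=
    ⟨fun a ha => h.parity_eq a (hiff a ha), fun a ha => by
      obtain ⟨a', haa, hs⟩ := h.exists_sat a ha
      exact ⟨a', haa, fun D hD => hs D (mem_of_mem_erase hD)⟩⟩
  exact absurd (hmin _ _ _ henc rfl) (not_le.mpr (card_erase_lt_of_mem hC))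

/-- In a minimal encoding, if an auxiliary variable occurs with one sign, it occurs at
least twice with the other sign: otherwise eliminating it would save a clause. -/
theorem EncodesParity.two_le_card_occ {F : Finset (Finset (Literal V))} {X : Finset V} {b : ZMod 2}
    (h : EncodesParity F X b) (hmin : IsMinimal F X) {v : V} (hv : v ∉ X) {c : Bool}
    {C : Finset (Literal V)} (hC : C ∈ F) (hc : (v, c) ∈ C) : 2 ≤ (occ F (v, !c)).card := by
  have hF := h.nonTautological hmin
  have h1 := hmin _ _ _ (h.eliminate hF hv) rfl
  have h2 := card_eliminate_add_le hF v
  have h3 : 0 < (occ F (v, c)).card := card_pos.mpr ⟨C, mem_occ.mpr ⟨hC, hc⟩⟩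
  by_contra! h4
  cases c
  · simp only [Bool.not_false] at h4
    interval_cases (occ F (v, true)).card <;> omega
  · simp only [Bool.not_true] at h4
    interval_cases (occ F (v, false)).card <;> omega

/-- If a literal of an input `x` occurs only once, then its clause contains, besides this literal,
only literals on auxiliary variables, at least one of them, and all of these are false whenever
the literal on `x` is true. -/
theorem EncodesParity.exists_clause_of_card_occ_le_one {F : Finset (Finset (Literal V))}
    {X : Finset V} {b : ZMod 2} (h : EncodesParity F X b) (hF : NonTautological F)
    (hX : 3 ≤ X.card) {x : V} (hx : x ∈ X) {c : Bool} (hocc : (occ F (x, c)).card ≤ 1) :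
    ∃ C ∈ F, (x, c) ∈ C ∧ (∀ l ∈ C, l ≠ (x, c) → l.1 ∉ X) ∧ (∃ l ∈ C, l ≠ (x, c)) ∧
      ∀ a, Satisfies a F → a x = c → ∀ l ∈ C, l ≠ (x, c) → a l.1 = !l.2 := by
  obtain ⟨a₀, hs₀, hx₀⟩ := h.exists_sat_eq hX hx c
  obtain ⟨C, hC, hcC, -⟩ := h.exists_critical hs₀ hx
  rw [hx₀] at hcC
  have hforced : ∀ a, Satisfies a F → a x = c → ∀ l ∈ C, l ≠ (x, c) → a l.1 = !l.2 := by
    intro a ha hax l hl hlx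
    obtain ⟨D, hD, hcD, hDl⟩ := h.exists_critical ha hx
    rw [hax] at hcD hDl
    obtain rfl : D = C := card_le_one.mp hocc D (mem_occ.mpr ⟨hD, hcD⟩) C (mem_occ.mpr ⟨hC, hcC⟩)
    exact Bool.eq_not_of_ne fun hal => hlx (hDl l hl hal)
  refine ⟨C, hC, hcC, ?_, ?_, hforced⟩
  · rintro ⟨z, d⟩ hl hlx hzX
    by_cases hzx : z = x
    · subst hzx
      have hdc : d = !c := Bool.eq_not_of_ne fun hdc => hlx (by rw [hdc])
      exact hF C hC _ _ hcC (hdc ▸ hl)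
    · obtain ⟨a, ha, hax, haz⟩ := h.exists_sat_of_ne hX hx hzX (Ne.symm hzx) c d
      have := hforced a ha hax _ hl hlx
      simp [haz] at this
  · by_contra! hno
    obtain ⟨a, ha, hax⟩ := h.exists_sat_eq hX hx (!c)
    obtain ⟨l, hl, hal⟩ := ha C hC
    obtain rfl := hno l hl
    simp [hax] at hal

/-- If a literal of an input occurs only once in a minimal encoding, then this literal and two
of its companions in the clause, all forced, satisfy at least four clauses. -/
theorem EncodesParity.exists_card_add_four_le {F : Finset (Finset (Literal V))} {X : Finset V}
    {b : ZMod 2} (h : EncodesParity F X b) (hmin : IsMinimal F X) (hX : 3 ≤ X.card) {x : V}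
    (hx : x ∈ X) {c : Bool} (hocc : (occ F (x, c)).card ≤ 1) :
    ∃ F' b', EncodesParity F' (X.erase x) b' ∧ F'.card + 4 ≤ F.card := by
  have hF := h.nonTautological hmin
  obtain ⟨C, hC, hcC, haux, ⟨⟨v, d⟩, hl, hlx⟩, hforced⟩ :=
    h.exists_clause_of_card_occ_le_one hF hX hx hocc
  have hvX := haux _ hl hlx
  obtain ⟨⟨u, e⟩, hk, hkx, hkl⟩ : ∃ k ∈ C, k ≠ (x, c) ∧ k ≠ (v, d) := by
    by_contra! hno
    -- Now `C` says that the two literals are complementary. After exchanging the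
    -- roles of `x` and `v`, the auxiliary variable `x` occurs only once with sign `c`.
    have heq : ∀ a, Satisfies a F → a v = (a x ^^ (c ^^ !d)) := by
      intro a ha
      by_cases hax : a x = c
      · rw [hforced a ha hax _ hl hlx, hax]
        cases c <;> simp
      · obtain ⟨k, hk, hak⟩ := ha C hC
        by_cases hkx : k = (x, c)
        · exact absurd (by rw [hkx] at hak; exact hak) hax
        · obtain rfl := hno k hk hkx
          rw [Bool.eq_not_of_ne hax]
          change a v = d at hak
          rw [hak]
          cases c <;> simp
    have hsw := h.swap hx hvX heq
    have hcard : (insert v (X.erase x)).card = X.card := by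
      rw [card_insert_of_notMem fun h => hvX (mem_of_mem_erase h), card_erase_add_one hx]
    have hxv : x ≠ v := fun h => hvX (h ▸ hx)
    obtain ⟨a, ha, hax⟩ := h.exists_sat_eq hX hx (!c)
    obtain ⟨D, hD, hcD, -⟩ := h.exists_critical ha hx
    rw [hax] at hcD
    have := hsw.two_le_card_occ (fun F' X' b' h' hc' => hmin F' X' b' h' (hc'.trans hcard))
      (by simp [hxv]) hD hcD
    rw [Bool.not_not] at this
    omega
  have huX := haux _ hk hkx
  have huv : u ≠ v := by
    rintro rfl
    have : e = !d := Bool.eq_not_of_ne fun hed => hkl (by rw [hed])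
    exact hF C hC _ _ hl (this ▸ hk)
  obtain ⟨a₀, hs₀, hx₀⟩ := h.exists_sat_eq hX hx c
  have hv₀ : a₀ v = !d := hforced a₀ hs₀ hx₀ _ hl hlx
  have hu₀ : a₀ u = !e := hforced a₀ hs₀ hx₀ _ hk hkx
  -- As the value of `u` is forced when `x = c`, flipping it violates a clause; that clause
  -- contains no other true literal, so it does not contain the negation of `(v, d)`.
  obtain ⟨D, hD, huD, hDl⟩ := exists_critical_of_flip hs₀ (v := u) fun hs => by
    have hxu : x ≠ u := fun h => huX (h ▸ hx)
    have := hforced _ hs (by rw [update_of_ne hxu, hx₀]) _ hk hkx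
    simp [hu₀] at this
  have hDv : D ∉ occ F (v, !d) := fun hDv => by
    have := hDl _ (mem_occ.mp hDv).2 hv₀
    exact huv (congrArg Prod.fst this).symm
  have hCn : C ∉ insert D (occ F (v, !d)) := by
    rw [mem_insert, not_or]
    refine ⟨?_, fun hCv => hF C hC _ _ hl (mem_occ.mp hCv).2⟩
    rintro rfl
    rw [hu₀] at huD
    exact hF C hC _ _ hk huD
  have htwo : 2 ≤ (occ F (v, !d)).card := h.two_le_card_occ hmin hvX hC hl
  refine ⟨_, _, h.restrict hx (T := {x, v, u}) (by simp) ?_ (a₀ := a₀) ?_, ?_⟩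
  · intro w hw hwX
    simp only [mem_insert, mem_singleton] at hw
    rcases hw with rfl | rfl | rfl
    · rfl
    · exact absurd hwX hvX
    · exact absurd hwX huX
  · intro a ha hax w hw
    simp only [mem_insert, mem_singleton] at hw
    rcases hw with rfl | rfl | rfl
    · exact hax
    · rw [hv₀]
      exact hforced a ha (hax.trans hx₀) _ hl hlx
    · rw [hu₀]
      exact hforced a ha (hax.trans hx₀) _ hk hkx
  · have hkill := card_restrict_add_le (F := F) (T := {x, v, u}) (a₀ := a₀)
      (K := insert C (insert D (occ F (v, !d)))) (by
        intro E hE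
        rcases mem_insert.mp hE with rfl | hE
        · exact ⟨hC, _, hcC, by simp, hx₀⟩
        rcases mem_insert.mp hE with rfl | hE
        · exact ⟨hD, _, huD, by simp, rfl⟩
        · exact ⟨(mem_occ.mp hE).1, _, (mem_occ.mp hE).2, by simp, hv₀⟩)
    rw [card_insert_of_notMem hCn, card_insert_of_notMem hDv] at hkill
    omega

/-! ### At least `3n - 9` clauses -/

theorem EncodesParity.exists_card_add_card_occ_le {F : Finset (Finset (Literal V))} {X : Finset V}
    {b : ZMod 2} (h : EncodesParity F X b) {x : V} (hx : x ∈ X) (c : Bool) :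
    ∃ b', EncodesParity (ParityEncoding.restrict F {x} fun _ => c) (X.erase x) b' ∧
      (ParityEncoding.restrict F {x} fun _ => c).card + (occ F (x, c)).card ≤ F.card :=
  ⟨_, h.restrict hx (mem_singleton_self x) (fun _ hv _ => mem_singleton.mp hv)
      (fun a _ hax v hv => by rw [mem_singleton.mp hv, hax]),
    card_restrict_add_le fun C hC =>
      ⟨(mem_occ.mp hC).1, _, (mem_occ.mp hC).2, by simp, rfl⟩⟩

/-- By strong induction on the number of clauses. In a minimal counterexample every literal of an
input occurs exactly twice, so some two inputs share a clause; then setting one of them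
leaves a literal of the other one with a single occurrence. -/
theorem EncodesParity.three_mul_card_le (m : ℕ) : ∀ {F : Finset (Finset (Literal V))}
    {X : Finset V} {b : ZMod 2}, EncodesParity F X b → F.card = m →
    3 * X.card ≤ F.card + 9 := by
  induction m using Nat.strong_induction_on with
  | _ m ih =>
  intro F X b h hm
  by_contra! hlt
  have hsmall : ∀ {F' X' b'}, EncodesParity (V := V) F' X' b' → F'.card < F.card →
      3 * X'.card ≤ F'.card + 9 := fun h' hc => ih _ (hm ▸ hc) h' rfl
  have hmin : IsMinimal F X := fun F' X' b' h' hc => by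
    by_contra! hc'
    have := hsmall h' hc'
    omega
  have hF := h.nonTautological hmin
  have hocc : ∀ x ∈ X, ∀ c, (occ F (x, c)).card = 2 := by
    intro x hx c
    have hX := card_erase_add_one hx
    by_contra hne
    by_cases h1 : (occ F (x, c)).card ≤ 1
    · obtain ⟨F', b', h', hc⟩ := h.exists_card_add_four_le hmin (by omega) hx h1
      have := hsmall h' (by omega)
      omega
    · obtain ⟨b', h', hc⟩ := h.exists_card_add_card_occ_le hx c
      have := hsmall h' (by omega)
      omega
  by_cases hshare : ∃ C ∈ F, ∃ l₁ ∈ C, ∃ l₂ ∈ C, l₁.1 ∈ X ∧ l₂.1 ∈ X ∧ l₁ ≠ l₂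
  · obtain ⟨C, hC, ⟨i, c⟩, hi, ⟨j, d⟩, hj, hiX, hjX, hne⟩ := hshare
    change i ∈ X at hiX
    change j ∈ X at hjX
    have hij : i ≠ j := by
      rintro rfl
      have : c = !d := Bool.eq_not_of_ne fun hcd => hne (by rw [hcd])
      exact hF C hC _ _ hj (this ▸ hi)
    obtain ⟨b', h', hc⟩ := h.exists_card_add_card_occ_le hjX d
    rw [hocc j hjX d] at hc
    have hXj := card_erase_add_one hjX
    have hiX' : i ∈ X.erase j := mem_erase.mpr ⟨hij, hiX⟩
    have hXi := card_erase_add_one hiX'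
    have hmin' : IsMinimal (ParityEncoding.restrict F {j} fun _ => d) (X.erase j) :=
      fun F'' X'' b'' h'' hc'' => by
        by_contra! hlt'
        have := hsmall h'' (by omega)
        omega
    -- the clause shared by the two literals is satisfied, which leaves one occurrence
    have hone : (occ (ParityEncoding.restrict F {j} fun _ => d) (i, c)).card ≤ 1 := by
      have hsub : occ (ParityEncoding.restrict F {j} fun _ => d) (i, c) ⊆
          ((occ F (i, c)).erase C).image fun C => C.filter fun l => l.1 ∉ ({j} : Finset V) := by
        intro E hE
        rw [mem_occ] at hE
        obtain ⟨D, hD, rfl⟩ := mem_image.mp hE.1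
        rw [mem_filter] at hD
        refine mem_image_of_mem _ (mem_erase.mpr ⟨?_, mem_occ.mpr
          ⟨hD.1, (mem_filter.mp hE.2).1⟩⟩)
        rintro rfl
        exact hD.2 _ hj (mem_singleton_self j) rfl
      refine (card_le_card hsub).trans (card_image_le.trans ?_)
      rw [card_erase_of_mem (mem_occ.mpr ⟨hC, hi⟩), hocc i hiX c]
    obtain ⟨F'', b'', h'', hc''⟩ := h'.exists_card_add_four_le hmin' (by omega) hiX' hone
    have := hsmall h'' (by omega)
    omega
  · push Not at hshare
    have hdisj : ((X ×ˢ (univ : Finset Bool) : Finset (Literal V)) : Set (Literal V)).PairwiseDisjoint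
        (occ F) := by
      intro l₁ h₁ l₂ h₂ hne
      refine disjoint_left.mpr fun C hC₁ hC₂ => hne ?_
      rw [mem_occ] at hC₁ hC₂
      exact hshare C hC₁.1 _ hC₁.2 _ hC₂.2 (mem_product.mp h₁).1 (mem_product.mp h₂).1
    have h1 : ((X ×ˢ (univ : Finset Bool)).biUnion (occ F)).card = X.card * 2 * 2 := by
      rw [card_biUnion hdisj, sum_const_nat (m := 2) fun l hl => hocc l.1 (mem_product.mp hl).1 l.2,
        card_product, card_univ, Fintype.card_bool]
    have h2 : (X ×ˢ (univ : Finset Bool)).biUnion (occ F) ⊆ F :=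
      biUnion_subset.mpr fun l _ => filter_subset _ _
    have h3 := card_le_card h2
    omega

end Formulas

/-! ### The satisfiability coding lemma -/

/-- The left-hand side counts the points of the subcubes through `x p` with free coordinates
`D p`. Two subcubes of the same colour `y p` are disjoint, since their centres differ at a coordinate
that is fixed in both. -/
theorem sum_two_pow_card_le {ι α β : Type*} [Fintype ι] [DecidableEq ι] [DecidableEq β]
    {P : Finset α} {Y : Finset β} {y : α → β} (hy : ∀ p ∈ P, y p ∈ Y) (x : α → ι → Bool)
    {D : α → Finset ι}
    (hD : ∀ p ∈ P, ∀ q ∈ P, y p = y q → p ≠ q → ∃ i, x p i ≠ x q i ∧ i ∉ D p ∧ i ∉ D q) :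
    ∑ p ∈ P, 2 ^ (D p).card ≤ Y.card * 2 ^ Fintype.card ι := by
  let Q : α → Finset (β × (ι → Bool)) := fun p =>
    {y p} ×ˢ Fintype.piFinset fun i => if i ∈ D p then univ else {x p i}
  have hQ : ∀ p, (Q p).card = 2 ^ (D p).card := by
    intro p
    rw [card_product, card_singleton, one_mul, Fintype.card_piFinset]
    have : ∀ i, (if i ∈ D p then (univ : Finset Bool) else {x p i}).card
        = if i ∈ D p then 2 else 1 := by
      intro i
      split_ifs <;> simp
    simp_rw [this]
    rw [prod_ite_mem, univ_inter, prod_const]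
  have hdisj : (P : Set α).PairwiseDisjoint Q := by
    intro p hp q hq hpq
    refine disjoint_left.mpr fun z hzp hzq => ?_
    simp only [Q, mem_product, mem_singleton, Fintype.mem_piFinset] at hzp hzq
    obtain ⟨i, hne, hip, hiq⟩ := hD p hp q hq (hzp.1.symm.trans hzq.1) hpq
    have h1 := hzp.2 i
    have h2 := hzq.2 i
    rw [if_neg hip, mem_singleton] at h1
    rw [if_neg hiq, mem_singleton] at h2
    exact hne (h1.symm.trans h2)
  have hsub : P.biUnion Q ⊆ Y ×ˢ univ := by
    refine biUnion_subset.mpr fun p hp => product_subset_product ?_ (subset_univ _)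
    exact singleton_subset_iff.mpr (hy p hp)
  have := card_le_card hsub
  rw [card_biUnion hdisj, card_product, card_univ, Fintype.card_fun, Fintype.card_bool] at this
  simpa only [hQ] using this

/-- In a random ordering each element of `A` comes last in `A` with probability `1 / |A|`. -/
theorem card_mul_card_perm_last {n : ℕ} {A : Finset (Fin n)} {i : Fin n} (hi : i ∈ A) :
    A.card * (univ.filter fun σ : Equiv.Perm (Fin n) => ∀ j ∈ A, σ j ≤ σ i).card
      = n.factorial := by
  have hsymm : ∀ k ∈ A, (univ.filter fun σ : Equiv.Perm (Fin n) => ∀ j ∈ A, σ j ≤ σ k).card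
      = (univ.filter fun σ : Equiv.Perm (Fin n) => ∀ j ∈ A, σ j ≤ σ i).card := by
    intro k hk
    have hswap : ∀ j ∈ A, Equiv.swap i k j ∈ A := by
      intro j hj
      rw [Equiv.swap_apply_def]
      split_ifs <;> assumption
    refine card_nbij' (fun σ => σ * Equiv.swap i k) (fun σ => σ * Equiv.swap i k) ?_ ?_ ?_ ?_
    · intro σ hσ
      simp only [coe_filter, mem_univ, true_and, Set.mem_ofPred_eq, Equiv.Perm.mul_apply,
        Equiv.swap_apply_left] at hσ ⊢
      exact fun j hj => hσ _ (hswap j hj)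
    · intro σ hσ
      simp only [coe_filter, mem_univ, true_and, Set.mem_ofPred_eq, Equiv.Perm.mul_apply,
        Equiv.swap_apply_right] at hσ ⊢
      exact fun j hj => hσ _ (hswap j hj)
    · intro σ _
      simp [mul_assoc]
    · intro σ _
      simp [mul_assoc]
  have hone : ∀ σ : Equiv.Perm (Fin n), (A.filter fun k => ∀ j ∈ A, σ j ≤ σ k).card = 1 := by
    intro σ
    obtain ⟨k, hk, hmax⟩ := exists_max_image A σ ⟨i, hi⟩
    refine card_eq_one.mpr ⟨k, eq_singleton_iff_unique_mem.mpr
      ⟨mem_filter.mpr ⟨hk, hmax⟩, fun k' hk' => ?_⟩⟩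
    rw [mem_filter] at hk'
    exact σ.injective (le_antisymm (hmax k' hk'.1) (hk'.2 k hk))
  have hcount := sum_card_bipartiteAbove_eq_sum_card_bipartiteBelow (s := A)
    (t := (univ : Finset (Equiv.Perm (Fin n)))) (fun k σ => ∀ j ∈ A, σ j ≤ σ k)
  simp only [bipartiteAbove, bipartiteBelow] at hcount
  rw [sum_congr rfl hsymm, sum_const, smul_eq_mul, sum_congr rfl fun σ _ => hone σ, sum_const,
    smul_eq_mul, mul_one, card_univ, Fintype.card_perm, Fintype.card_fin] at hcount
  exact hcount

/-- The line through `(T, 2 ^ T)` and `(T + 1, 2 ^ (T + 1))` is below `2 ^ d` at the integers. -/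
theorem two_pow_mul_le (d T : ℕ) : (2 : ℝ) ^ T * (1 + d - T) ≤ 2 ^ d := by
  rcases le_or_gt T d with h | h
  · obtain ⟨k, rfl⟩ := Nat.exists_eq_add_of_le h
    rw [pow_add]
    refine mul_le_mul_of_nonneg_left ?_ (by positivity)
    have : (k : ℝ) + 1 ≤ 2 ^ k := by exact_mod_cast Nat.lt_two_pow_self
    push_cast
    linarith
  · have : (d : ℝ) + 1 ≤ T := by exact_mod_cast h
    exact (mul_nonpos_of_nonneg_of_nonpos (by positivity) (by linarith)).trans (by positivity)

/-- A form of the satisfiability coding lemma of Paturi, Pudlák and Zane. The points of `S` have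
colours in `Y`, and `A x i` is the set of inputs of a critical clause for `x` in direction `i`: a
point of `S` of the same colour that differs from `x` at `i` differs from `x` elsewhere on
`A x i`. Scanning the coordinates in a random order, `i` comes last in `A x i`, and is thus
determined by the coordinates before, with probability `1 / |A x i|`. -/
theorem sum_inv_card_le {n : ℕ} {β : Type*} [DecidableEq β] {S : Finset (Fin n → Bool)}
    {Y : Finset β} {y : (Fin n → Bool) → β} (hy : ∀ x ∈ S, y x ∈ Y)
    {A : (Fin n → Bool) → Fin n → Finset (Fin n)} (hA : ∀ x ∈ S, ∀ i, i ∈ A x i)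
    (hcrit : ∀ x ∈ S, ∀ x' ∈ S, y x = y x' → ∀ i, x i ≠ x' i →
      ∃ j ∈ A x i, j ≠ i ∧ x j ≠ x' j)
    {T : ℕ} (hT : Y.card * 2 ^ n ≤ 2 ^ T * S.card) :
    ∑ x ∈ S, ∑ i, ((A x i).card : ℝ)⁻¹ ≤ T * S.card := by
  let D : Equiv.Perm (Fin n) → (Fin n → Bool) → Finset (Fin n) := fun σ x =>
    univ.filter fun i => ∀ j ∈ A x i, σ j ≤ σ i
  have hσ : ∀ σ, ∑ x ∈ S, ((D σ x).card : ℝ) ≤ T * S.card := by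
    intro σ
    have hcube : ∑ x ∈ S, 2 ^ (D σ x).card ≤ Y.card * 2 ^ n := by
      have := sum_two_pow_card_le hy (fun x : Fin n → Bool => x) (D := D σ) ?_
      · rwa [Fintype.card_fin] at this
      intro x hx x' hx' hyy hne
      obtain ⟨k, hk⟩ := Function.ne_iff.mp hne
      -- the first coordinate where `x` and `x'` differ is determined in neither of them
      obtain ⟨i, hi, hmin⟩ := exists_min_image (univ.filter fun i => x i ≠ x' i) σ
        ⟨k, mem_filter.mpr ⟨mem_univ _, hk⟩⟩
      rw [mem_filter] at hi
      refine ⟨i, hi.2, fun hiD => ?_, fun hiD => ?_⟩ <;> rw [mem_filter] at hiD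
      · obtain ⟨j, hj, hji, hne⟩ := hcrit x hx x' hx' hyy i hi.2
        exact hji (σ.injective (le_antisymm (hiD.2 j hj)
          (hmin j (mem_filter.mpr ⟨mem_univ _, hne⟩))))
      · obtain ⟨j, hj, hji, hne⟩ := hcrit x' hx' x hx hyy.symm i hi.2.symm
        exact hji (σ.injective (le_antisymm (hiD.2 j hj)
          (hmin j (mem_filter.mpr ⟨mem_univ _, hne.symm⟩))))
    have h1 : ∑ x ∈ S, (2 : ℝ) ^ (D σ x).card ≤ 2 ^ T * S.card := by
      exact_mod_cast hcube.trans hT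
    have h2 := (sum_le_sum fun x (_ : x ∈ S) => two_pow_mul_le (D σ x).card T).trans h1
    rw [← mul_sum] at h2
    have h3 := le_of_mul_le_mul_left h2 (by positivity)
    rw [sum_sub_distrib, sum_add_distrib, sum_const, sum_const, nsmul_eq_mul, nsmul_eq_mul] at h3
    linarith
  have hcount : ∑ σ, ∑ x ∈ S, ((D σ x).card : ℝ)
      = n.factorial * ∑ x ∈ S, ∑ i, ((A x i).card : ℝ)⁻¹ := by
    rw [sum_comm, mul_sum]
    refine sum_congr rfl fun x hx => ?_
    rw [mul_sum]
    have h1 : ∑ σ, (D σ x).card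
        = ∑ i, (univ.filter fun σ : Equiv.Perm (Fin n) => ∀ j ∈ A x i, σ j ≤ σ i).card :=
      sum_card_bipartiteAbove_eq_sum_card_bipartiteBelow
        (fun (σ : Equiv.Perm (Fin n)) i => ∀ j ∈ A x i, σ j ≤ σ i)
    rw [← Nat.cast_sum, h1, Nat.cast_sum]
    refine sum_congr rfl fun i _ => ?_
    have h2 : ((A x i).card : ℝ) ≠ 0 := by
      exact_mod_cast (card_pos.mpr ⟨i, hA x hx i⟩).ne'
    rw [← card_mul_card_perm_last (hA x hx i), Nat.cast_mul]
    field_simp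
  have hsum := sum_le_sum fun σ (_ : σ ∈ (univ : Finset (Equiv.Perm (Fin n)))) => hσ σ
  rw [hcount, sum_const, card_univ, Fintype.card_perm, Fintype.card_fin, nsmul_eq_mul] at hsum
  exact le_of_mul_le_mul_left hsum (by exact_mod_cast n.factorial_pos)

/-! ### Critical clauses of a parity encoding -/

variable {n s : ℕ}

/-- The underlying clauses of a formula. -/
def clauses {V : Type*} [DecidableEq V] (F : CNF V) : Finset (Finset (Literal V)) :=
  F.image Subtype.val

/-- The inputs that occur in a clause. -/
def inputVars (C : Finset (Literal (Fin n ⊕ Fin s))) : Finset (Fin n) :=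
  univ.filter fun j => ∃ c, (Sum.inl j, c) ∈ C

theorem satisfies_clauses {V : Type*} [DecidableEq V] {F : CNF V} {a : V → Bool} :
    Satisfies a (clauses F) ↔ CNF.IsSat F a := by
  simp only [Satisfies, clauses, forall_mem_image, CNF.IsSat, Clause.IsSat]

theorem nonTautological_clauses {V : Type*} [DecidableEq V] (F : CNF V) :
    NonTautological (clauses F) := by
  intro C hC v c hc hc'
  obtain ⟨C, -, rfl⟩ := mem_image.mp hC
  cases c
  · exact C.2 v ⟨hc', hc⟩
  · exact C.2 v ⟨hc, hc'⟩

theorem parity_eq_true_iff (x : Fin n → Bool) : parity n x = true ↔ parityOn univ x = 1 := by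
  rw [parity, decide_eq_true_iff, parityOn, sum_boole, ZMod.natCast_eq_one_iff_odd]

theorem parityOn_map_inl (a : Fin n ⊕ Fin s → Bool) :
    parityOn (univ.map Embedding.inl) a = parityOn univ fun i => a (Sum.inl i) :=
  sum_map _ _ _

theorem encodesParity_of_encodes {F : CNF (Fin n ⊕ Fin s)} (h : CNF.Encodes F (parity n)) :
    EncodesParity (clauses F) (univ.map Embedding.inl) 1 where
  parity_eq a ha := by
    rw [parityOn_map_inl, ← parity_eq_true_iff, h]
    refine ⟨fun j => a (Sum.inr j), ?_⟩
    rw [satisfies_clauses] at ha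
    convert ha using 1
    exact Sum.elim_comp_inl_inr a
  exists_sat a ha := by
    rw [parityOn_map_inl, ← parity_eq_true_iff, h] at ha
    obtain ⟨y, hy⟩ := ha
    refine ⟨_, ?_, satisfies_clauses.mpr hy⟩
    simp

/-- Half of the inputs are odd. -/
theorem two_mul_card_parity (hn : 1 ≤ n) :
    2 * (univ.filter fun x : Fin n → Bool => parity n x = true).card = 2 ^ n := by
  let i : Fin n := ⟨0, hn⟩
  have hflip : ∀ x : Fin n → Bool, parity n (update x i (!x i)) = true ↔ ¬ parity n x = true := by
    intro x
    rw [parity_eq_true_iff, parity_eq_true_iff, parityOn_flip (mem_univ i)]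
    generalize parityOn univ x = p
    revert p
    decide
  have hinv : ∀ x : Fin n → Bool,
      update (update x i (!x i)) i (!(update x i (!x i)) i) = x := by
    intro x
    simp
  have h1 : (univ.filter fun x : Fin n → Bool => parity n x = true).card
      = (univ.filter fun x : Fin n → Bool => ¬ parity n x = true).card := by
    refine card_nbij' (fun x => update x i (!x i)) (fun x => update x i (!x i)) ?_ ?_ ?_ ?_
    · intro x hx
      simp only [coe_filter, mem_univ, true_and, Set.mem_ofPred_eq, hflip] at hx ⊢
      exact not_not_intro hx
    · intro x hx
      simp only [coe_filter, mem_univ, true_and, Set.mem_ofPred_eq, hflip] at hx ⊢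
      exact hx
    · exact fun x _ => hinv x
    · exact fun x _ => hinv x
  have h2 := card_filter_add_card_filter_not (s := (univ : Finset (Fin n → Bool)))
    (fun x => parity n x = true)
  rw [card_univ, Fintype.card_pi_const, Fintype.card_bool] at h2
  omega

/-- For each odd `x` and each input `i` there is a clause `C x i` of `F` that is critical for `x`
in direction `i`. On average over `x`, the reciprocals of the numbers of inputs of these
clauses add up to at most `s + 1`; and a clause with `w` inputs is used for at most `w 2ⁿ⁻ʷ`
pairs `(x, i)`. -/
theorem exists_criticalClauses {F : CNF (Fin n ⊕ Fin s)} (h : CNF.Encodes F (parity n))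
    (hn : 1 ≤ n) :
    ∃ (S : Finset (Fin n → Bool))
      (C : (Fin n → Bool) → Fin n → Finset (Literal (Fin n ⊕ Fin s))),
      2 * S.card = 2 ^ n ∧
      (∀ x ∈ S, ∀ i, C x i ∈ clauses F ∧ i ∈ inputVars (C x i)) ∧
      ∑ x ∈ S, ∑ i, ((inputVars (C x i)).card : ℝ)⁻¹ ≤ (s + 1 : ℕ) * S.card ∧
      ∀ E, ((S ×ˢ (univ : Finset (Fin n))).filter fun p => C p.1 p.2 = E).card
        * 2 ^ (inputVars E).card ≤ (inputVars E).card * 2 ^ n := by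
  have henc := encodesParity_of_encodes h
  have hF := nonTautological_clauses F
  let S := univ.filter fun x : Fin n → Bool => parity n x = true
  have hS : ∀ x, x ∈ S → ∃ y : Fin s → Bool, Satisfies (Sum.elim x y) (clauses F) := by
    intro x hx
    obtain ⟨y, hy⟩ := (h x).mp (mem_filter.mp hx).2
    exact ⟨y, satisfies_clauses.mpr hy⟩
  choose! y hy using hS
  have hC : ∀ x, x ∈ S → ∀ i, ∃ C ∈ clauses F, (Sum.inl i, x i) ∈ C ∧
      ∀ l ∈ C, Sum.elim x (y x) l.1 = l.2 → l = (Sum.inl i, x i) := fun x hx i =>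
    henc.exists_critical (hy x hx) (mem_map_of_mem Embedding.inl (mem_univ i))
  choose! C hCF hCi hCl using hC
  have hA : ∀ x ∈ S, ∀ i, i ∈ inputVars (C x i) := fun x hx i =>
    mem_filter.mpr ⟨mem_univ _, _, hCi x hx i⟩
  have hcard : 2 * S.card = 2 ^ n := two_mul_card_parity hn
  refine ⟨S, C, hcard, fun x hx i => ⟨hCF x hx i, hA x hx i⟩, ?_, fun E => ?_⟩
  · refine sum_inv_card_le (Y := univ) (y := y) (fun _ _ => mem_univ _) hA ?_ ?_
    · intro x hx x' hx' hyy i hi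
      obtain ⟨⟨v, c⟩, hl, hal⟩ := hy x' hx' _ (hCF x hx i)
      rcases v with j | j
      · refine ⟨j, mem_filter.mpr ⟨mem_univ _, c, hl⟩, ?_, fun hxj => ?_⟩
        · rintro rfl
          have hc : c = !x j := Bool.eq_not_of_ne fun hc => hi (hc.symm.trans hal.symm)
          exact hF _ (hCF x hx j) _ _ (hCi x hx j) (hc ▸ hl)
        · have := hCl x hx i _ hl (hxj.trans hal)
          simp only [Prod.mk.injEq, Sum.inl.injEq] at this
          obtain ⟨rfl, rfl⟩ := this
          exact hi hal.symm
      · have := hCl x hx i _ hl (by rw [hyy]; exact hal)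
        simp at this
    · rw [card_univ, Fintype.card_pi_const, Fintype.card_bool, ← hcard, pow_succ, mul_assoc]
  · -- On the inputs of `E`, an input for which `E` is critical in direction `i` falsifies all
    -- literals except the one on `i`, so it is determined by `i`.
    have hdet : ∀ p ∈ (S ×ˢ (univ : Finset (Fin n))).filter fun p => C p.1 p.2 = E,
        ∀ j ∈ inputVars E,
          p.1 j = if j = p.2 then !decide ((Sum.inl j, false) ∈ E) else
            decide ((Sum.inl j, false) ∈ E) := by
      rintro ⟨x, i⟩ hp j hj
      rw [mem_filter, mem_product] at hp
      obtain ⟨⟨hx, -⟩, rfl⟩ := hp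
      change x j = if j = i then _ else _
      change x ∈ S at hx
      obtain ⟨c, hc⟩ := (mem_filter.mp hj).2
      split_ifs with hji
      · subst hji
        have h1 := hCi x hx j
        have h2 := hF _ (hCF x hx j) _ _ h1
        cases hxj : x j <;> rw [hxj] at h1 h2
        · simp [h1]
        · simpa using h2
      · have h1 : ∀ c, (Sum.inl j, c) ∈ C x i → x j ≠ c := fun c hc hxc => hji (by
          simpa using congrArg Prod.fst (hCl x hx i _ hc hxc))
        by_cases h0 : (Sum.inl j, false) ∈ C x i
        · simpa [h0] using h1 _ h0
        · cases c
          · exact absurd hc h0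
          · simpa [h0] using h1 _ hc
    have := sum_two_pow_card_le
      (P := (S ×ˢ (univ : Finset (Fin n))).filter fun p => C p.1 p.2 = E)
      (Y := inputVars E) (y := Prod.snd) ?_ Prod.fst (D := fun _ => inputVars E) ?_
    · simpa using this
    · rintro ⟨x, i⟩ hp
      rw [mem_filter, mem_product] at hp
      exact hp.2 ▸ hA x hp.1.1 i
    · rintro ⟨x, i⟩ hp ⟨x', i'⟩ hq hii hne
      obtain rfl : i = i' := hii
      obtain ⟨j, hj⟩ := Function.ne_iff.mp fun hxx : x = x' => hne (by rw [hxx])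
      have hjE : j ∉ inputVars E := fun hjE =>
        hj ((hdet _ hp j hjE).trans (hdet _ hq j hjE).symm)
      exact ⟨j, hj, hjE, hjE⟩

/-! ### The lower bounds -/

theorem card_clauses_le {V : Type*} [DecidableEq V] (F : CNF V) :
    (clauses F).card ≤ CNF.numClauses F :=
  card_image_le

theorem card_inputVars_le_width {F : CNF (Fin n ⊕ Fin s)} {C : Finset (Literal (Fin n ⊕ Fin s))}
    (hC : C ∈ clauses F) : (inputVars C).card ≤ CNF.width F := by
  obtain ⟨C, hCF, rfl⟩ := mem_image.mp hC
  have h1 : ((inputVars C.1).map (Embedding.inl (β := Fin s))).card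
      ≤ (C.1.image Prod.fst).card := by
    refine card_le_card fun v hv => ?_
    obtain ⟨j, hj, rfl⟩ := mem_map.mp hv
    obtain ⟨c, hc⟩ := (mem_filter.mp hj).2
    exact mem_image.mpr ⟨_, hc, rfl⟩
  rw [card_map] at h1
  exact (h1.trans card_image_le).trans (le_sup (f := fun C : Clause _ => C.1.card) hCF)

theorem div_le_width {F : CNF (Fin n ⊕ Fin s)} (h : CNF.Encodes F (parity n)) :
    (n : ℝ) / ((s : ℝ) + 1) ≤ (CNF.width F : ℝ) := by
  rcases Nat.eq_zero_or_pos n with rfl | hn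
  · simp
  obtain ⟨S, C, hS, hC, hinv, -⟩ := exists_criticalClauses h hn
  have hSpos : 0 < S.card := by
    have := Nat.two_pow_pos n
    omega
  have hle : ∀ x ∈ S, ∀ i, ((CNF.width F : ℝ))⁻¹ ≤ ((inputVars (C x i)).card : ℝ)⁻¹ := by
    intro x hx i
    have hpos : 0 < (inputVars (C x i)).card := card_pos.mpr ⟨i, (hC x hx i).2⟩
    exact inv_anti₀ (by exact_mod_cast hpos) (by exact_mod_cast card_inputVars_le_width (hC x hx i).1)
  have hwpos : 0 < CNF.width F := by
    obtain ⟨x, hx⟩ := card_pos.mp hSpos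
    exact (card_pos.mpr ⟨_, (hC x hx ⟨0, hn⟩).2⟩).trans_le
      (card_inputVars_le_width (hC x hx ⟨0, hn⟩).1)
  have hsum := (sum_le_sum fun x hx => sum_le_sum fun i (_ : i ∈ univ) => hle x hx i).trans hinv
  simp only [sum_const, card_univ, Fintype.card_fin, nsmul_eq_mul] at hsum
  rw [mul_comm ((s + 1 : ℕ) : ℝ)] at hsum
  have h1 := le_of_mul_le_mul_left hsum (by exact_mod_cast hSpos)
  have hw : (0 : ℝ) < CNF.width F := by exact_mod_cast hwpos
  rw [← div_eq_mul_inv, div_le_iff₀ hw] at h1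
  push_cast at h1
  rw [div_le_iff₀ (by positivity)]
  linarith

/-- Each clause contributes at most `2ⁿ` to the sum of `2ʷ / w` over all pairs `(x, i)`. -/
theorem sum_two_pow_mul_inv_le {S : Finset (Fin n → Bool)}
    {C : (Fin n → Bool) → Fin n → Finset (Literal (Fin n ⊕ Fin s))}
    {G : Finset (Finset (Literal (Fin n ⊕ Fin s)))} (hC : ∀ x ∈ S, ∀ i, C x i ∈ G)
    (hcount : ∀ E, ((S ×ˢ (univ : Finset (Fin n))).filter fun p => C p.1 p.2 = E).card
        * 2 ^ (inputVars E).card ≤ (inputVars E).card * 2 ^ n) :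
    ∑ x ∈ S, ∑ i, (2 : ℝ) ^ (inputVars (C x i)).card * ((inputVars (C x i)).card : ℝ)⁻¹
      ≤ G.card * 2 ^ n := by
  rw [← sum_product' S univ fun x i =>
    (2 : ℝ) ^ (inputVars (C x i)).card * ((inputVars (C x i)).card : ℝ)⁻¹,
    ← sum_fiberwise_of_maps_to (t := G) (g := fun p => C p.1 p.2)
      fun p hp => hC p.1 (mem_product.mp hp).1 p.2, ← nsmul_eq_mul, ← sum_const]
  refine sum_le_sum fun E _ => ?_
  rw [sum_congr rfl (g := fun _ => (2 : ℝ) ^ (inputVars E).card * ((inputVars E).card : ℝ)⁻¹)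
    fun p hp => by rw [(mem_filter.mp hp).2], sum_const, nsmul_eq_mul, ← mul_assoc]
  rcases Nat.eq_zero_or_pos (inputVars E).card with h0 | hpos
  · simp [h0]
  · rw [← div_eq_mul_inv, div_le_iff₀ (by exact_mod_cast hpos), mul_comm ((2 : ℝ) ^ n)]
    exact_mod_cast hcount E

/-- The tangent to `2 ^ w` at `t`, divided by `w`. -/
theorem two_rpow_mul_le {w : ℕ} (hw : 0 < w) (t : ℝ) :
    (2 : ℝ) ^ t * ((1 - t * Real.log 2) * (w : ℝ)⁻¹ + Real.log 2) ≤ 2 ^ w * (w : ℝ)⁻¹ := by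
  have hw' : (0 : ℝ) < w := by exact_mod_cast hw
  have h1 : (2 : ℝ) ^ w = 2 ^ t * 2 ^ ((w : ℝ) - t) := by
    rw [← Real.rpow_add two_pos, add_sub_cancel, Real.rpow_natCast]
  have h2 : ((w : ℝ) - t) * Real.log 2 + 1 ≤ 2 ^ ((w : ℝ) - t) := by
    rw [Real.rpow_def_of_pos two_pos, mul_comm (Real.log 2)]
    exact Real.add_one_le_exp _
  have h3 : (1 - t * Real.log 2) * (w : ℝ)⁻¹ + Real.log 2
      = (((w : ℝ) - t) * Real.log 2 + 1) * (w : ℝ)⁻¹ := by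
    field_simp
    ring
  rw [h1, h3, mul_assoc]
  gcongr

/-- The common source of both size bounds. Summing the tangent inequality at `t = n / (s + 1)` over
all pairs `(x, i)`, the coefficient `1 - t log 2` of the sum of the `1 / w` may have either sign:
this sum is bounded below by `0` in one case and above by `sum_inv_card_le` in the other. -/
theorem two_rpow_mul_min_le {F : CNF (Fin n ⊕ Fin s)} (h : CNF.Encodes F (parity n))
    (hn : 1 ≤ n) :
    (2 : ℝ) ^ ((n : ℝ) / ((s : ℝ) + 1)) * min ((s : ℝ) + 1) (n * Real.log 2)
      ≤ 2 * (CNF.numClauses F : ℝ) := by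
  obtain ⟨S, C, hS, hC, hinv, hcount⟩ := exists_criticalClauses h hn
  have hup := sum_two_pow_mul_inv_le (fun x hx i => (hC x hx i).1) hcount
  have hS' : (2 : ℝ) ^ n = 2 * S.card := by exact_mod_cast hS.symm
  have hSpos : (0 : ℝ) < S.card := by
    have : (0 : ℝ) < 2 ^ n := by positivity
    linarith
  set t : ℝ := (n : ℝ) / ((s : ℝ) + 1) with ht
  have hts : t * ((s : ℝ) + 1) = n := div_mul_cancel₀ _ (by positivity)
  set U := ∑ x ∈ S, ∑ i, ((inputVars (C x i)).card : ℝ)⁻¹ with hU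
  have hU0 : 0 ≤ U := sum_nonneg fun x _ => sum_nonneg fun i _ => by positivity
  have hlow : (2 : ℝ) ^ t * ((1 - t * Real.log 2) * U + S.card * (n * Real.log 2))
      ≤ ∑ x ∈ S, ∑ i, (2 : ℝ) ^ (inputVars (C x i)).card * ((inputVars (C x i)).card : ℝ)⁻¹ := by
    have := sum_le_sum fun x hx => sum_le_sum fun i (_ : i ∈ univ) =>
      two_rpow_mul_le (card_pos.mpr ⟨i, (hC x hx i).2⟩) t
    refine le_trans (le_of_eq ?_) this
    simp only [← mul_sum, sum_add_distrib, sum_const, card_univ, Fintype.card_fin, nsmul_eq_mul, hU]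
    ring
  have hlog : 0 < Real.log 2 := Real.log_pos one_lt_two
  have hmin : min ((s : ℝ) + 1) (n * Real.log 2) * S.card
      ≤ (1 - t * Real.log 2) * U + S.card * (n * Real.log 2) := by
    rcases le_total (t * Real.log 2) 1 with h1 | h1
    · have h2 : 0 ≤ (1 - t * Real.log 2) * U := mul_nonneg (by linarith) hU0
      have h3 := mul_le_mul_of_nonneg_right (min_le_right ((s : ℝ) + 1) (n * Real.log 2)) hSpos.le
      linarith
    · have h2 : (1 - t * Real.log 2) * ((s + 1 : ℕ) * S.card) ≤ (1 - t * Real.log 2) * U :=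
        mul_le_mul_of_nonpos_left hinv (by linarith)
      have h3 := mul_le_mul_of_nonneg_right (min_le_left ((s : ℝ) + 1) (n * Real.log 2)) hSpos.le
      have h4 : (1 - t * Real.log 2) * ((s + 1 : ℕ) * S.card) + S.card * (n * Real.log 2)
          = ((s : ℝ) + 1) * S.card := by
        rw [← hts]
        push_cast
        ring
      linarith
  have hcard : ((clauses F).card : ℝ) ≤ CNF.numClauses F := by exact_mod_cast card_clauses_le F
  have h1 : (2 : ℝ) ^ t * (min ((s : ℝ) + 1) (n * Real.log 2) * S.card)
      ≤ (clauses F).card * 2 ^ n :=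
    (mul_le_mul_of_nonneg_left hmin (by positivity)).trans (hlow.trans hup)
  rw [hS', ← mul_assoc, ← mul_assoc] at h1
  have h2 := le_of_mul_le_mul_right h1 hSpos
  linarith

theorem three_mul_sub_nine_le {F : CNF (Fin n ⊕ Fin s)} (h : CNF.Encodes F (parity n)) :
    3 * (n : ℤ) - 9 ≤ (CNF.numClauses F : ℤ) := by
  have h1 := EncodesParity.three_mul_card_le _ (encodesParity_of_encodes h) rfl
  rw [card_map, card_univ, Fintype.card_fin] at h1
  have h2 := card_clauses_le F
  omega

end ParityEncoding

theorem theorem1 :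
    (∀ K : ℝ, ∃ c : ℝ, 0 < c ∧
      ∀ (n s : ℕ) (F : CNF (Fin n ⊕ Fin s)),
        1 ≤ n → (s : ℝ) ≤ K * (n : ℝ) → CNF.Encodes F (parity n) →
          c * ((((s : ℝ) + 1) / (n : ℝ)) * (2 : ℝ) ^ ((n : ℝ) / ((s : ℝ) + 1)))
            ≤ (CNF.numClauses F : ℝ)) ∧
    (∃ c : ℝ, 0 < c ∧
      ∀ (n s : ℕ) (F : CNF (Fin n ⊕ Fin s)),
        1 ≤ n → CNF.Encodes F (parity n) →
          c * ((2 : ℝ) ^ ((n : ℝ) / ((s : ℝ) + 1)) / (n : ℝ)) ≤ (CNF.numClauses F : ℝ)) ∧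
    (∀ (n s : ℕ) (F : CNF (Fin n ⊕ Fin s)), CNF.Encodes F (parity n) →
      (n : ℝ) / ((s : ℝ) + 1) ≤ (CNF.width F : ℝ)) ∧
    (∀ (n s : ℕ) (F : CNF (Fin n ⊕ Fin s)), CNF.Encodes F (parity n) →
      3 * (n : ℤ) - 9 ≤ (CNF.numClauses F : ℤ)) := by
  -- The constants come from `2 m ≥ 2ᵗ min (s + 1, n log 2)` and `log 2 ≥ 1 / 2`; for the first bound,
  -- also from `(s + 1) / n ≤ |K| + 1`.
  have hlog : (1 / 2 : ℝ) ≤ Real.log 2 := by linarith [Real.log_two_gt_d9]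
  refine ⟨fun K => ⟨1 / (4 * (|K| + 1)), by positivity, ?_⟩, ⟨1 / 4, by norm_num, ?_⟩,
    fun n s F h => ParityEncoding.div_le_width h,
    fun n s F h => ParityEncoding.three_mul_sub_nine_le h⟩
  · intro n s F hn hs h
    have hmain := ParityEncoding.two_rpow_mul_min_le h hn
    have hn' : (1 : ℝ) ≤ n := by exact_mod_cast hn
    have hK := mul_le_mul_of_nonneg_right (le_abs_self K) (zero_le_one.trans hn')
    set P : ℝ := (2 : ℝ) ^ ((n : ℝ) / ((s : ℝ) + 1))
    have hP : 0 < P := by positivity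
    have hmin : ((s : ℝ) + 1) / n / (2 * (|K| + 1)) ≤ min ((s : ℝ) + 1) (n * Real.log 2) := by
      refine le_min ?_ ?_
      · rw [div_div]
        refine div_le_self (by positivity) ?_
        nlinarith [abs_nonneg K]
      · have h1 : ((s : ℝ) + 1) / n ≤ |K| + 1 := by
          rw [div_le_iff₀ (by linarith)]
          linarith
        have h2 : ((s : ℝ) + 1) / n / (2 * (|K| + 1)) ≤ 1 / 2 := by
          rw [div_le_iff₀ (by positivity)]
          linarith
        nlinarith
    have h1 := mul_le_mul_of_nonneg_left hmin hP.le
    have h2 : 1 / (4 * (|K| + 1)) * (((s : ℝ) + 1) / n * P)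
        = P * (((s : ℝ) + 1) / n / (2 * (|K| + 1))) / 2 := by
      field_simp
      norm_num
    rw [h2]
    linarith
  · intro n s F hn h
    have hmain := ParityEncoding.two_rpow_mul_min_le h hn
    have hn' : (1 : ℝ) ≤ n := by exact_mod_cast hn
    set P : ℝ := (2 : ℝ) ^ ((n : ℝ) / ((s : ℝ) + 1))
    have hP : 0 < P := by positivity
    have hmin : (1 / 2 : ℝ) ≤ min ((s : ℝ) + 1) (n * Real.log 2) := by
      refine le_min ?_ ?_
      · have : (0 : ℝ) ≤ s := by positivity
        linarith
      · nlinarith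
    have h1 := mul_le_mul_of_nonneg_left hmin hP.le
    have h2 : P / n ≤ P := div_le_self hP.le hn'
    linarith
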